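/- Let $n\ge 2$ and $k$ be integers, and let $\mathrm{SO}(n,1)$ denote the identity component of the group of real $(n+1)\times(n+1)$ matrices of determinant one preserving the quadratic form $Q(x_0,\dots,x_n)=4x_0x_n-(x_1^2+\cdots+x_{n-1}^2)$. Put $H=(\mathrm{SO}(n,1))^k$, and for $t\in\mathbb{R}$ and $\mathbf{x}\in\mathbb{R}^{n-1}$ (a column vector with transpose $\mathbf{x}^{T}$) put $$b(t)=\begin{bmatrix}e^{2t}&&\\&\mathrm{I}_{n-1}&\\&&e^{-2t}\end{bmatrix},\qquad u(\mathbf{x})=\begin{bmatrix}1&\mathbf{x}^{T}&\|\mathbf{x}\|_2^2\\&\mathrm{I}_{n-1}&2\mathbf{x}\\&&1\end{bmatrix},$$ both of which lie in $\mathrm{SO}(n,1)$. Let $u_k(\mathbf{x}_1,\dots,\mathbf{x}_k)=(u(\mathbf{x}_1),\dots,u(\mathbf{x}_k))\in H$. Fix $\eta_1,\dots,\eta_k>0$ and let $A=\{a(t)=(b(\eta_1t),\dots,b(\eta_kt)):t\in\mathbb{R}\}\subset H$. For $(\mathbf{x}_1,\dots,\mathbf{x}_k)\in(\mathbb{R}^{n-1})^k$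 with all $\mathbf{x}_i\ne\mathbf{0}$ define $(\mathbf{x}_1,\dots,\mathbf{x}_k)^{-1}=(\mathbf{x}_1/\|\mathbf{x}_1\|_2^2,\dots,\mathbf{x}_k/\|\mathbf{x}_k\|_2^2)$. Let $I=[c,d]$ with $c<d$ and let $\varphi:I\to(\mathbb{R}^{n-1})^k$ be an analytic curve such that for some $s_0\in I$: (i) $(\varphi(s)-\varphi(s_0))^{-1}$ is defined for almost every $s\in I$; (ii) the set of all $(\varphi(s_1)-\varphi(s_0))^{-1}-(\varphi(s_2)-\varphi(s_0))^{-1}$, where $s_1,s_2$ run over the points of $I$ at which these inverses are defined, is not contained in any proper linear subspace of $(\mathbb{R}^{n-1})^k$. Let $V$ be a finite-dimensional real vector space with a continuous linear representation of $H$. For $\omega\in\mathbb{R}$ let $V^{\omega}(A)=\{v\in V: a(t)v=e^{\omega t}v\text{ for all }t\in\mathbb{R}\}$, and let $V^{-0}(A)=\bigoplus_{\omega\le 0}V^{\omega}(A)$. If a nonzero vector $v\in V$ satisfies $u_k(\varphi(s))v\in V^{-0}(A)$ for all $s\in I$, then $v$ is fixed by $H$, that is, $hv=v$ for all $h\in H$.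 -/

import Mathlib

open MeasureTheory Set

noncomputable section

namespace SOn1

/-- The index set `{0} ⊔ {1, …, n-1} ⊔ {n}` of the coordinates `(x₀, x₁, …, x_{n-1}, x_n)`. -/
abbrev Idx (n : ℕ) : Type := Unit ⊕ (Fin (n - 1) ⊕ Unit)

/-- The Euclidean space `ℝ^{n-1}`, with the norm `‖·‖₂`. -/
abbrev E (n : ℕ) : Type := EuclideanSpace ℝ (Fin (n - 1))

/-- The quadratic form `Q(x₀, …, x_n) = 4 x₀ x_n - (x₁² + ⋯ + x_{n-1}²)`. -/
def Q {n : ℕ} (y : Idx n → ℝ) : ℝ :=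
  4 * y (.inl ()) * y (.inr (.inr ())) - ∑ i : Fin (n - 1), y (.inr (.inl i)) ^ 2

/-- The matrices of determinant one which preserve `Q`. -/
def specialOrthogonal (n : ℕ) : Subgroup (Matrix.SpecialLinearGroup (Idx n) ℝ) where
  carrier := {g | ∀ y : Idx n → ℝ, Q (Matrix.mulVec (g : Matrix (Idx n) (Idx n) ℝ) y) = Q y}
  one_mem' := by
    intro y
    simp
  mul_mem' := by
    intro g h hg hh y
    rw [Matrix.SpecialLinearGroup.coe_mul, ← Matrix.mulVec_mulVec, hg, hh]
  inv_mem' := by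
    intro g hg y
    have h := hg (Matrix.mulVec ((g⁻¹ : Matrix.SpecialLinearGroup (Idx n) ℝ) :
      Matrix (Idx n) (Idx n) ℝ) y)
    rw [Matrix.mulVec_mulVec, ← Matrix.SpecialLinearGroup.coe_mul, mul_inv_cancel,
      Matrix.SpecialLinearGroup.coe_one, Matrix.one_mulVec] at h
    exact h.symm

/-- `SO(n,1)`: the identity component of the group of matrices of determinant one
which preserve `Q`, with its topology as a group of matrices. -/
abbrev SO (n : ℕ) : Type := Subgroup.connectedComponentOfOne (specialOrthogonal n)

/-- The group `H = SO(n,1)^k`. -/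
abbrev H (n k : ℕ) : Type := Fin k → SO n

/-- The diagonal matrix `diag(e^{2t}, 1, …, 1, e^{-2t})`. -/
def bMat (n : ℕ) (t : ℝ) : Matrix (Idx n) (Idx n) ℝ :=
  Matrix.fromBlocks (Matrix.of fun _ _ => Real.exp (2 * t)) 0 0
    (Matrix.fromBlocks 1 0 0 (Matrix.of fun _ _ => Real.exp (-(2 * t))))

/-- The upper triangular matrix with rows `(1, x, ‖x‖²)`, `(0, I, 2 x)`, `(0, 0, 1)`. -/
def uMat {n : ℕ} (x : E n) : Matrix (Idx n) (Idx n) ℝ :=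
  Matrix.fromBlocks 1 (Matrix.of fun _ j => Sum.elim (fun i => x i) (fun _ => ‖x‖ ^ 2) j) 0
    (Matrix.fromBlocks 1 (Matrix.of fun i _ => 2 * x i) 0 1)

lemma bMat_det (n : ℕ) (t : ℝ) : (bMat n t).det = 1 := by
  simp [bMat, Matrix.det_fromBlocks_zero₂₁, ← Real.exp_add]

lemma uMat_det {n : ℕ} (x : E n) : (uMat x).det = 1 := by
  simp [uMat, Matrix.det_fromBlocks_zero₂₁]

lemma bMat_Q (n : ℕ) (t : ℝ) (y : Idx n → ℝ) : Q (Matrix.mulVec (bMat n t) y) = Q y := by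
  have h : Real.exp (2 * t) * Real.exp (-(2 * t)) = 1 := by simp [← Real.exp_add]
  simp [Q, bMat, Matrix.mulVec, dotProduct, Matrix.one_apply]
  linear_combination 4 * y (.inl ()) * y (.inr (.inr ())) * h

lemma uMat_Q {n : ℕ} (x : E n) (y : Idx n → ℝ) : Q (Matrix.mulVec (uMat x) y) = Q y := by
  simp [Q, uMat, Matrix.mulVec, dotProduct, Matrix.one_apply, EuclideanSpace.norm_sq_eq]
  simp only [add_sq, Finset.sum_add_distrib]
  have h1 : ∑ i : Fin (n - 1), 2 * y (.inr (.inl i)) * (2 * x i * y (.inr (.inr ())))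
      = 4 * (∑ i : Fin (n - 1), x i * y (.inr (.inl i))) * y (.inr (.inr ())) := by
    rw [Finset.mul_sum, Finset.sum_mul]
    exact Finset.sum_congr rfl fun i _ => by ring
  have h2 : ∑ i : Fin (n - 1), (2 * x i * y (.inr (.inr ()))) ^ 2
      = 4 * (∑ i : Fin (n - 1), x i ^ 2) * y (.inr (.inr ())) ^ 2 := by
    rw [Finset.mul_sum, Finset.sum_mul]
    exact Finset.sum_congr rfl fun i _ => by ring
  rw [h1, h2]
  ring

lemma bMat_continuous (n : ℕ) : Continuous (bMat n) := by
  refine continuous_matrix fun i j => ?_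
  rcases i with i | i | i <;> rcases j with j | j | j <;> simp [bMat] <;> fun_prop

lemma uMat_continuous (n : ℕ) : Continuous (uMat : E n → Matrix (Idx n) (Idx n) ℝ) := by
  refine continuous_matrix fun i j => ?_
  rcases i with i | i | i <;> rcases j with j | j | j <;> simp [uMat] <;> fun_prop

/-- `b(t)` as an element of the special orthogonal group of `Q`. -/
def bAux (n : ℕ) (t : ℝ) : specialOrthogonal n := ⟨⟨bMat n t, bMat_det n t⟩, bMat_Q n t⟩

/-- `u(x)` as an element of the special orthogonal group of `Q`. -/
def uAux {n : ℕ} (x : E n) : specialOrthogonal n := ⟨⟨uMat x, uMat_det x⟩, uMat_Q x⟩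

lemma mem_component {X : Type*} [TopologicalSpace X] [PreconnectedSpace X] {n : ℕ}
    (f : X → specialOrthogonal n) (hf : Continuous f) (x₀ : X) (h₀ : f x₀ = 1) (x : X) :
    f x ∈ Subgroup.connectedComponentOfOne (specialOrthogonal n) :=
  (isPreconnected_range hf).subset_connectedComponent (h₀ ▸ mem_range_self x₀) (mem_range_self x)

lemma bAux_mem (n : ℕ) (t : ℝ) :
    bAux n t ∈ Subgroup.connectedComponentOfOne (specialOrthogonal n) := by
  refine mem_component (bAux n) ?_ 0 ?_ t
  · exact ((bMat_continuous n).subtype_mk _).subtype_mk _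
  · apply Subtype.ext
    apply Subtype.ext
    ext i j
    rcases i with i | i | i <;> rcases j with j | j | j <;>
      simp [bAux, bMat, Matrix.one_apply]

lemma uAux_mem {n : ℕ} (x : E n) :
    uAux x ∈ Subgroup.connectedComponentOfOne (specialOrthogonal n) := by
  refine mem_component uAux ?_ 0 ?_ x
  · exact ((uMat_continuous n).subtype_mk _).subtype_mk _
  · apply Subtype.ext
    apply Subtype.ext
    ext i j
    rcases i with i | i | i <;> rcases j with j | j | j <;>
      simp [uAux, uMat, Matrix.one_apply]

/-- The one-parameter group `b(t)` in `SO(n,1)`. -/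
def b (n : ℕ) (t : ℝ) : SO n := ⟨bAux n t, bAux_mem n t⟩

/-- The parametrization `u : ℝ^{n-1} → SO(n,1)` of the expanding horospherical subgroup. -/
def u {n : ℕ} (x : E n) : SO n := ⟨uAux x, uAux_mem x⟩

/-- `a(t) = (b(η₁ t), …, b(η_k t))`. -/
def a (n : ℕ) {k : ℕ} (η : Fin k → ℝ) (t : ℝ) : H n k := fun i => b n (η i * t)

/-- `u_k(x₁, …, x_k) = (u(x₁), …, u(x_k))`. -/
def uk {n k : ℕ} (x : Fin k → E n) : H n k := fun i => u (x i)

/-- `(x₁, …, x_k)⁻¹ = (x₁ / ‖x₁‖², …, x_k / ‖x_k‖²)`; it is used only where `InvDefined x`. -/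
def inv {n k : ℕ} (x : Fin k → E n) : Fin k → E n := fun i => (‖x i‖ ^ 2)⁻¹ • x i

/-- `(x₁, …, x_k)⁻¹` is defined: every component is nonzero. -/
def InvDefined {n k : ℕ} (x : Fin k → E n) : Prop := ∀ i, x i ≠ 0

/-- The geometric condition on a curve `φ : [c, d] → (ℝ^{n-1})^k`: for some `s₀ ∈ [c, d]`,
`(φ(s) - φ(s₀))⁻¹` is defined for almost every `s ∈ [c, d]`, and the differences
`(φ(s₁) - φ(s₀))⁻¹ - (φ(s₂) - φ(s₀))⁻¹`, for all `s₁, s₂` where they are defined,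
do not lie in a common proper linear subspace. -/
def GeometricCondition {n k : ℕ} (c d : ℝ) (φ : ℝ → Fin k → E n) : Prop :=
  ∃ s₀ ∈ Icc c d,
    (∀ᵐ s ∂(volume.restrict (Icc c d)), InvDefined (φ s - φ s₀)) ∧
    ¬ ∃ W : Submodule ℝ (Fin k → E n), W ≠ ⊤ ∧
      ∀ s₁ ∈ Icc c d, ∀ s₂ ∈ Icc c d,
        InvDefined (φ s₁ - φ s₀) → InvDefined (φ s₂ - φ s₀) →
          inv (φ s₁ - φ s₀) - inv (φ s₂ - φ s₀) ∈ W

section Weights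

variable {G V : Type*} [Group G] [AddCommGroup V] [Module ℝ V]

/-- `V^w(D) = {v : D(t) v = e^{w t} v for all t}`. -/
def weightSpace (ρ : Representation ℝ G V) (D : ℝ → G) (w : ℝ) : Submodule ℝ V where
  carrier := {v | ∀ t : ℝ, ρ (D t) v = Real.exp (w * t) • v}
  add_mem' := by
    intro x y hx hy t
    rw [map_add, hx t, hy t, smul_add]
  zero_mem' := by
    intro t
    simp
  smul_mem' := by
    intro c x hx t
    rw [map_smul, hx t, smul_comm]

/-- `V^{-0}(D)`, the (direct) sum of the `V^w(D)` with `w ≤ 0`. -/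
def nonposSpace (ρ : Representation ℝ G V) (D : ℝ → G) : Submodule ℝ V :=
  ⨆ (w : ℝ) (_ : w ≤ 0), weightSpace ρ D w

end Weights

end SOn1

end

/-! Everything is deduced from boundedness of orbits under `a(t)`, so no weight decomposition of `V`
is needed: a vector of `V^{-0}(A)` has a bounded forward orbit. Write `u⁻` for the opposite
horospherical group, which `a(t)` contracts to the identity; contracted elements preserve forward
boundedness.

If all components of `x` are nonzero, then `u(x) = u⁻(x⁻¹) w u⁻(x⁻¹)`, where `w` inverts `A`
(`u_eq`, `b_mul_weyl`). Let `v₀ = u(φ(s₀))v` and `x = φ(s) - φ(s₀)`. Since `u(x)v₀` is forward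
bounded, so is `w u⁻(x⁻¹)v₀`; hence `u⁻(x⁻¹)v₀` is backward bounded, and it is forward bounded as
well (`ukm_inv_apply_mem`).

Fix one such point, giving `v₁`; the others are `u⁻(z)v₁` with `z` a difference of inverses. The
forward orbit of `u⁻(z)v₁ - v₁` tends to zero while its backward orbit is bounded, so it vanishes
(`Contracts.apply_eq`). The `z` for which `u⁻(z)` fixes `v₁` form a linear subspace, because a
unipotent operator fixes every vector with bounded orbit (`apply_eq_of_contracts`). The spanning
condition makes this subspace everything. Reversing time, `u` fixes `v₁` too (`fixed_of_ukm_fixed`).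
The two horospherical groups generate `H`, so `v₁` is `H`-fixed; as `v` lies in its orbit, `v = v₁`.
-/

open Filter Topology Asymptotics

noncomputable section

namespace SOn1

/-! ### Coordinates, horospherical elements and their relations -/

/-- The vector with coordinates `x₀ = p`, `(x₁, …, x_{n-1}) = y`, `x_n = q`. -/
def mk {n : ℕ} (p : ℝ) (y : E n) (q : ℝ) : Idx n → ℝ :=
  Sum.elim (fun _ => p) (Sum.elim y.ofLp (fun _ => q))

lemma exists_mk {n : ℕ} (z : Idx n → ℝ) : ∃ p y q, z = mk p y q := by
  refine ⟨z (.inl ()), WithLp.toLp 2 fun i => z (.inr (.inl i)), z (.inr (.inr ())), ?_⟩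
  ext i
  rcases i with i | i | i <;> rfl

lemma mk_inj {n : ℕ} {p p' q q' : ℝ} {y y' : E n} :
    mk p y q = mk p' y' q' ↔ p = p' ∧ y = y' ∧ q = q' := by
  constructor
  · intro h
    refine ⟨congrFun h (.inl ()), ?_, congrFun h (.inr (.inr ()))⟩
    ext i
    exact congrFun h (.inr (.inl i))
  · rintro ⟨rfl, rfl, rfl⟩
    rfl

lemma mk_add {n : ℕ} (p p' q q' : ℝ) (y y' : E n) :
    mk p y q + mk p' y' q' = mk (p + p') (y + y') (q + q') := by
  ext i
  rcases i with i | i | i <;> simp [mk]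

lemma smul_mk {n : ℕ} (c p q : ℝ) (y : E n) : c • mk p y q = mk (c * p) (c • y) (c * q) := by
  ext i
  rcases i with i | i | i <;> simp [mk]

lemma Q_mk {n : ℕ} (p q : ℝ) (y : E n) : Q (mk p y q) = 4 * p * q - ‖y‖ ^ 2 := by
  simp [Q, mk, EuclideanSpace.norm_sq_eq]

lemma matrix_ext_mk {n : ℕ} {A B : Matrix (Idx n) (Idx n) ℝ}
    (h : ∀ p y q, A.mulVec (mk p y q) = B.mulVec (mk p y q)) : A = B := by
  apply Matrix.ext_of_mulVec_single
  intro i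
  obtain ⟨p, y, q, hz⟩ := exists_mk (Pi.single i (1 : ℝ) : Idx n → ℝ)
  rw [hz, h]

lemma bMat_mulVec_mk {n : ℕ} (t p q : ℝ) (y : E n) :
    (bMat n t).mulVec (mk p y q) = mk (Real.exp (2 * t) * p) y (Real.exp (-(2 * t)) * q) := by
  ext i
  rcases i with i | i | i <;> simp [bMat, mk, Matrix.mulVec, dotProduct, Matrix.one_apply]

lemma uMat_mulVec_mk {n : ℕ} (x : E n) (p q : ℝ) (y : E n) :
    (uMat x).mulVec (mk p y q) =
      mk (p + inner ℝ x y + ‖x‖ ^ 2 * q) (y + (2 * q) • x) q := by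
  ext i
  rcases i with i | i | i <;>
    simp [uMat, mk, Matrix.mulVec, dotProduct, Matrix.one_apply, PiLp.inner_apply]
  · simp only [mul_comm, add_assoc]
  · ring

/-- The exchange of the coordinates `x₀` and `x_n`. -/
def flip (n : ℕ) : Equiv.Perm (Idx n) where
  toFun := Sum.elim (fun _ => .inr (.inr ())) (Sum.elim (fun i => .inr (.inl i)) fun _ => .inl ())
  invFun := Sum.elim (fun _ => .inr (.inr ())) (Sum.elim (fun i => .inr (.inl i)) fun _ => .inl ())
  left_inv := by rintro (i | i | i) <;> rfl
  right_inv := by rintro (i | i | i) <;> rfl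

lemma mk_comp_flip {n : ℕ} (p q : ℝ) (y : E n) : mk p y q ∘ flip n = mk q y p := by
  ext i
  rcases i with i | i | i <;> rfl

lemma flip_symm (n : ℕ) : (flip n).symm = flip n := rfl

/-- The lower triangular counterpart of `uMat`. -/
def umMat {n : ℕ} (x : E n) : Matrix (Idx n) (Idx n) ℝ :=
  (uMat x).submatrix (flip n) (flip n)

lemma umMat_mulVec_mk {n : ℕ} (x : E n) (p q : ℝ) (y : E n) :
    (umMat x).mulVec (mk p y q) =
      mk p (y + (2 * p) • x) (q + inner ℝ x y + ‖x‖ ^ 2 * p) := by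
  rw [umMat, Matrix.submatrix_mulVec_equiv, flip_symm, mk_comp_flip, uMat_mulVec_mk, mk_comp_flip]

lemma umMat_Q {n : ℕ} (x : E n) (z : Idx n → ℝ) : Q (Matrix.mulVec (umMat x) z) = Q z := by
  obtain ⟨p, y, q, rfl⟩ := exists_mk z
  have h := uMat_Q x (mk q y p)
  rw [uMat_mulVec_mk, Q_mk, Q_mk] at h
  rw [umMat_mulVec_mk, Q_mk, Q_mk]
  linarith

/-- The lower triangular unipotent `u⁻(x)` in the special orthogonal group of `Q`. -/
def umAux {n : ℕ} (x : E n) : specialOrthogonal n :=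
  ⟨⟨umMat x, by rw [umMat, Matrix.det_submatrix_equiv_self, uMat_det]⟩, umMat_Q x⟩

lemma umAux_continuous (n : ℕ) : Continuous (umAux : E n → specialOrthogonal n) :=
  (((uMat_continuous n).matrix_submatrix _ _).subtype_mk _).subtype_mk _

lemma umAux_zero (n : ℕ) : umAux (0 : E n) = 1 := by
  apply Subtype.ext
  apply Subtype.ext
  apply matrix_ext_mk
  intro p y q
  simp [umAux, umMat_mulVec_mk]

lemma umAux_mem {n : ℕ} (x : E n) :
    umAux x ∈ Subgroup.connectedComponentOfOne (specialOrthogonal n) :=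
  mem_component umAux (umAux_continuous n) 0 (umAux_zero n) x

/-- The parametrization of the contracting horospherical subgroup of `SO(n,1)`. -/
def um {n : ℕ} (x : E n) : SO n := ⟨umAux x, umAux_mem x⟩

/-- The matrix of an element of `SO(n,1)`. -/
def toMat {n : ℕ} (g : SO n) : Matrix (Idx n) (Idx n) ℝ := g.1.1.1

lemma toMat_inj {n : ℕ} {g h : SO n} (e : toMat g = toMat h) : g = h :=
  Subtype.ext (Subtype.ext (Subtype.ext e))

lemma toMat_mul {n : ℕ} (g h : SO n) : toMat (g * h) = toMat g * toMat h := rfl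
lemma toMat_one {n : ℕ} : toMat (1 : SO n) = 1 := rfl
lemma toMat_u {n : ℕ} (x : E n) : toMat (u x) = uMat x := rfl
lemma toMat_um {n : ℕ} (x : E n) : toMat (um x) = umMat x := rfl
lemma toMat_b (n : ℕ) (t : ℝ) : toMat (b n t) = bMat n t := rfl

lemma SO_ext {n : ℕ} {g h : SO n}
    (e : ∀ p y q, (toMat g).mulVec (mk p y q) = (toMat h).mulVec (mk p y q)) : g = h :=
  toMat_inj (matrix_ext_mk e)

lemma u_add {n : ℕ} (x y : E n) : u (x + y) = u x * u y := by
  apply SO_ext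
  intro p z q
  simp only [toMat_mul, ← Matrix.mulVec_mulVec, toMat_u, uMat_mulVec_mk, mk_inj]
  refine ⟨?_, by module, trivial⟩
  rw [inner_add_left, inner_add_right, inner_smul_right, norm_add_sq_real]
  ring

lemma um_add {n : ℕ} (x y : E n) : um (x + y) = um x * um y := by
  apply SO_ext
  intro p z q
  simp only [toMat_mul, ← Matrix.mulVec_mulVec, toMat_um, umMat_mulVec_mk, mk_inj]
  refine ⟨trivial, by module, ?_⟩
  rw [inner_add_left, inner_add_right, inner_smul_right, norm_add_sq_real]
  ring

lemma um_zero (n : ℕ) : um (0 : E n) = 1 := Subtype.ext (umAux_zero n)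

lemma u_zero (n : ℕ) : u (0 : E n) = 1 := by
  apply SO_ext
  intro p y q
  simp [toMat_u, toMat_one, uMat_mulVec_mk]

lemma b_add (n : ℕ) (s t : ℝ) : b n (s + t) = b n s * b n t := by
  apply SO_ext
  intro p y q
  simp only [toMat_mul, ← Matrix.mulVec_mulVec, toMat_b, bMat_mulVec_mk, mk_inj]
  refine ⟨?_, trivial, ?_⟩
  · rw [mul_add, Real.exp_add]; ring
  · rw [mul_add, neg_add, Real.exp_add]; ring

lemma b_mul_u {n : ℕ} (t : ℝ) (x : E n) : b n t * u x = u (Real.exp (2 * t) • x) * b n t := by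
  have h : Real.exp (2 * t) * Real.exp (-(2 * t)) = 1 := by simp [← Real.exp_add]
  apply SO_ext
  intro p y q
  simp only [toMat_mul, ← Matrix.mulVec_mulVec, toMat_b, toMat_u, bMat_mulVec_mk, uMat_mulVec_mk,
    mk_inj, norm_smul, smul_smul, real_inner_smul_left, Real.norm_eq_abs, Real.abs_exp]
  refine ⟨?_, ?_, trivial⟩
  · linear_combination (-Real.exp (2 * t) * ‖x‖ ^ 2 * q) * h
  · congr 2
    linear_combination (-2 * q) * h

lemma b_mul_um {n : ℕ} (t : ℝ) (x : E n) :
    b n t * um x = um (Real.exp (-(2 * t)) • x) * b n t := by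
  have h : Real.exp (2 * t) * Real.exp (-(2 * t)) = 1 := by simp [← Real.exp_add]
  apply SO_ext
  intro p y q
  simp only [toMat_mul, ← Matrix.mulVec_mulVec, toMat_b, toMat_um, bMat_mulVec_mk, umMat_mulVec_mk,
    mk_inj, norm_smul, smul_smul, real_inner_smul_left, Real.norm_eq_abs, Real.abs_exp]
  refine ⟨trivial, ?_, ?_⟩
  · congr 2
    linear_combination (-2 * p) * h
  · linear_combination (-Real.exp (-(2 * t)) * ‖x‖ ^ 2 * p) * h

/-! ### Inversion and Weyl elements -/

/-- The inversion `x / ‖x‖²` of a vector. -/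
def inversion {n : ℕ} (x : E n) : E n := (‖x‖ ^ 2)⁻¹ • x

/-- The Weyl element attached to a nonzero vector. -/
def weyl {n : ℕ} (x : E n) : SO n := um (-inversion x) * u x * um (-inversion x)

/-- Formal from the definition of `weyl`; the content is that for `x ≠ 0` the middle factor inverts
`b`. -/
lemma u_eq {n : ℕ} (x : E n) : u x = um (inversion x) * weyl x * um (inversion x) := by
  have h : um (inversion x) * um (-inversion x) = 1 := by
    rw [← um_add, add_neg_cancel, um_zero]
  have h' : um (-inversion x) * um (inversion x) = 1 := by
    rw [← um_add, neg_add_cancel, um_zero]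
  rw [weyl, ← mul_assoc, ← mul_assoc, h, one_mul, mul_assoc, h', mul_one]

/-- The Weyl element swaps the two isotropic axes up to the scale `‖x‖²` and reflects the middle
block in the hyperplane orthogonal to `x`. -/
lemma weyl_mulVec_mk {n : ℕ} {x : E n} (hx : x ≠ 0) (p q : ℝ) (y : E n) :
    (toMat (weyl x)).mulVec (mk p y q) =
      mk (‖x‖ ^ 2 * q) (y - (2 * (‖x‖ ^ 2)⁻¹ * inner ℝ x y) • x) ((‖x‖ ^ 2)⁻¹ * p) := by
  have hx : ‖x‖ ^ 2 ≠ 0 := by simpa using hx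
  have hr : inner ℝ x x = ‖x‖ ^ 2 := real_inner_self_eq_norm_sq x
  have hn : ‖-inversion x‖ ^ 2 = (‖x‖ ^ 2)⁻¹ := by
    rw [← real_inner_self_eq_norm_sq, inversion, inner_neg_neg, real_inner_smul_left,
      real_inner_smul_right, hr]
    field_simp
  simp only [weyl, toMat_mul, ← Matrix.mulVec_mulVec, toMat_u, toMat_um, uMat_mulVec_mk,
    umMat_mulVec_mk, mk_inj, hn]
  simp only [inversion, inner_neg_left, real_inner_smul_left, inner_add_right, inner_neg_right,
    real_inner_smul_right, hr]
  set r := ‖x‖ ^ 2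
  set d : ℝ := inner ℝ x y
  refine ⟨?_, ?_, ?_⟩
  · field_simp
    ring
  · match_scalars
    · ring
    · field_simp
      ring
  · field_simp
    ring

lemma b_mul_weyl {n : ℕ} (t : ℝ) {x : E n} (hx : x ≠ 0) :
    b n t * weyl x = weyl x * b n (-t) := by
  apply SO_ext
  intro p y q
  simp only [toMat_mul, ← Matrix.mulVec_mulVec, toMat_b, bMat_mulVec_mk, weyl_mulVec_mk hx, mk_inj]
  refine ⟨?_, trivial, ?_⟩
  · rw [mul_neg, neg_neg]; ring
  · rw [mul_neg]; ring

lemma u_continuous (n : ℕ) : Continuous (u : E n → SO n) :=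
  (((uMat_continuous n).subtype_mk _).subtype_mk _).subtype_mk _

lemma um_continuous (n : ℕ) : Continuous (um : E n → SO n) :=
  (umAux_continuous n).subtype_mk _

/-! ### Generation of `SO(n,1)` by horospherical subgroups -/

/-- The action of the special orthogonal group of `Q` on column vectors. -/
def act {n : ℕ} (g : specialOrthogonal n) (z : Idx n → ℝ) : Idx n → ℝ := g.1.1.mulVec z

lemma act_mul {n : ℕ} (g h : specialOrthogonal n) (z : Idx n → ℝ) :
    act (g * h) z = act g (act h z) :=
  (Matrix.mulVec_mulVec z g.1.1 h.1.1).symm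

lemma act_one {n : ℕ} (z : Idx n → ℝ) : act 1 z = z := Matrix.one_mulVec z

lemma act_inv_eq {n : ℕ} {g : specialOrthogonal n} {z w : Idx n → ℝ} (h : act g z = w) :
    act g⁻¹ w = z := by
  rw [← h, ← act_mul, inv_mul_cancel, act_one]

lemma act_add {n : ℕ} (g : specialOrthogonal n) (z w : Idx n → ℝ) :
    act g (z + w) = act g z + act g w := Matrix.mulVec_add _ _ _

lemma act_smul {n : ℕ} (g : specialOrthogonal n) (c : ℝ) (z : Idx n → ℝ) :
    act g (c • z) = c • act g z := Matrix.mulVec_smul _ _ _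

lemma Q_act {n : ℕ} (g : specialOrthogonal n) (z : Idx n → ℝ) : Q (act g z) = Q z := g.2 z

lemma act_ext {n : ℕ} {g h : specialOrthogonal n}
    (e : ∀ p y q, act g (mk p y q) = act h (mk p y q)) : g = h :=
  Subtype.ext (Subtype.ext (matrix_ext_mk e))

lemma flip_eq_swap (n : ℕ) : flip n = Equiv.swap (.inl ()) (.inr (.inr ())) := by
  ext1 i
  rcases i with i | i | i
  · exact (Equiv.swap_apply_left _ _).symm
  · change (.inr (.inl i) : Idx n) = _
    rw [Equiv.swap_apply_of_ne_of_ne (by simp) (by simp)]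
  · exact (Equiv.swap_apply_right _ _).symm

/-- A transposition has determinant `-1`. This excludes the wrong parity in `mem_of_fixes`. -/
lemma exists_mk_ne_flip {n : ℕ} (g : specialOrthogonal n) :
    ¬ ∀ p y q, act g (mk p y q) = mk q y p := by
  intro h
  have e : (g.1.1 : Matrix (Idx n) (Idx n) ℝ) = (flip n).permMatrix ℝ := by
    apply matrix_ext_mk
    intro p y q
    rw [Matrix.permMatrix_mulVec, mk_comp_flip]
    exact h p y q
  have hd := g.1.2
  rw [e, Matrix.det_permutation, flip_eq_swap, Equiv.Perm.sign_swap (by simp)] at hd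
  norm_num at hd

lemma weyl_unit {n : ℕ} {x : E n} (hx : ‖x‖ = 1) (p q : ℝ) (y : E n) :
    act (weyl x).1 (mk p y q) = mk q ((ℝ ∙ x)ᗮ.reflection y) p := by
  have hx0 : x ≠ 0 := by
    rintro rfl
    simp at hx
  refine (weyl_mulVec_mk hx0 p q y).trans ?_
  rw [Submodule.reflection_orthogonal_apply, Submodule.reflection_singleton_apply]
  simp only [mk_inj, hx]
  refine ⟨by ring, ?_, by ring⟩
  simp only [RCLike.ofReal_real_eq_id, id]
  module

section Generation

variable {n : ℕ} {T : Subgroup (specialOrthogonal n)}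

lemma weyl_mem (hu : ∀ x : E n, (u x).1 ∈ T) (hum : ∀ x : E n, (um x).1 ∈ T) (x : E n) :
    (weyl x).1 ∈ T :=
  T.mul_mem (T.mul_mem (hum _) (hu _)) (hum _)

lemma exists_unit (hn : 2 ≤ n) : ∃ x : E n, ‖x‖ = 1 :=
  ⟨EuclideanSpace.single ⟨0, by omega⟩ 1, by simp⟩

/-- In the product of the Weyl elements of two parallel vectors the reflections cancel and only the
ratio of the scales survives. -/
lemma b_mem (hn : 2 ≤ n) (hu : ∀ x : E n, (u x).1 ∈ T) (hum : ∀ x : E n, (um x).1 ∈ T) (t : ℝ) :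
    (b n t).1 ∈ T := by
  obtain ⟨x, hx⟩ := exists_unit hn
  have hx0 : x ≠ 0 := by
    rintro rfl
    simp at hx
  have e : b n t = weyl x * weyl (Real.exp (-t) • x) := by
    apply SO_ext
    intro p y q
    have hc : Real.exp (-t) • x ≠ 0 := smul_ne_zero (Real.exp_pos _).ne' hx0
    have h1 : Real.exp (2 * t) = (Real.exp (-t) ^ 2)⁻¹ := by
      rw [← Real.exp_nat_mul, ← Real.exp_neg]
      congr 1
      push_cast
      ring
    have h2 : Real.exp (-(2 * t)) = Real.exp (-t) ^ 2 := by
      rw [← Real.exp_nat_mul]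
      congr 1
      push_cast
      ring
    have hxx : inner ℝ x x = (1 : ℝ) := by rw [real_inner_self_eq_norm_sq, hx, one_pow]
    have hpos := (Real.exp_pos (-t)).ne'
    simp only [toMat_mul, ← Matrix.mulVec_mulVec, toMat_b, bMat_mulVec_mk, weyl_mulVec_mk hx0,
      weyl_mulVec_mk hc, mk_inj, norm_smul, hx, Real.norm_eq_abs, Real.abs_exp, h1, h2,
      real_inner_smul_left, inner_sub_right, real_inner_smul_right, hxx]
    refine ⟨by ring, ?_, by ring⟩
    match_scalars
    · ring
    · field_simp
      ring
  rw [e]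
  exact T.mul_mem (weyl_mem hu hum _) (weyl_mem hu hum _)

/-- Reflections generate the isometries, but a unit Weyl element reflects only while swapping the
two isotropic axes. The alternative records the parity of the number of reflections. -/
lemma exists_mem_act_isometry (hu : ∀ x : E n, (u x).1 ∈ T) (hum : ∀ x : E n, (um x).1 ∈ T)
    (R : E n ≃ₗᵢ[ℝ] E n) :
    (∃ h ∈ T, ∀ p y q, act h (mk p y q) = mk p (R y) q) ∨
      ∃ h ∈ T, ∀ p y q, act h (mk p y q) = mk q (R y) p := by
  have hR : R ∈ Subgroup.closure (range fun v : E n => (ℝ ∙ v)ᗮ.reflection) := by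
    rw [LinearIsometryEquiv.reflections_generate]
    trivial
  induction hR using Subgroup.closure_induction with
  | mem R hR =>
    obtain ⟨v, rfl⟩ := hR
    by_cases hv : v = 0
    · left
      refine ⟨1, T.one_mem, fun p y q => ?_⟩
      subst hv
      rw [act_one, Submodule.reflection_orthogonal_apply, Submodule.reflection_singleton_apply]
      simp
    · right
      have hv' : ‖v‖ ≠ 0 := norm_ne_zero_iff.mpr hv
      refine ⟨_, weyl_mem hu hum (‖v‖⁻¹ • v), fun p y q => ?_⟩
      rw [weyl_unit (by rw [norm_smul, norm_inv, norm_norm, inv_mul_cancel₀ hv'])]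
      have hs : (ℝ ∙ (‖v‖⁻¹ • v)) = ℝ ∙ v :=
        Submodule.span_singleton_smul_eq (IsUnit.mk0 _ (inv_ne_zero hv')) v
      simp only [hs]
  | one => exact Or.inl ⟨1, T.one_mem, fun p y q => by rw [act_one]; rfl⟩
  | mul R R' _ _ h h' =>
    rcases h with ⟨g, hg, e⟩ | ⟨g, hg, e⟩ <;> rcases h' with ⟨g', hg', e'⟩ | ⟨g', hg', e'⟩
    · exact Or.inl ⟨g * g', T.mul_mem hg hg', fun p y q => by rw [act_mul, e', e]; rfl⟩
    · exact Or.inr ⟨g * g', T.mul_mem hg hg', fun p y q => by rw [act_mul, e', e]; rfl⟩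
    · exact Or.inr ⟨g * g', T.mul_mem hg hg', fun p y q => by rw [act_mul, e', e]; rfl⟩
    · exact Or.inl ⟨g * g', T.mul_mem hg hg', fun p y q => by rw [act_mul, e', e]; rfl⟩
  | inv R _ h =>
    have hi : ∀ y, R (R⁻¹ y) = y := fun y => R.apply_symm_apply y
    rcases h with ⟨g, hg, e⟩ | ⟨g, hg, e⟩
    · exact Or.inl ⟨g⁻¹, T.inv_mem hg, fun p y q => act_inv_eq (by rw [e, hi])⟩
    · exact Or.inr ⟨g⁻¹, T.inv_mem hg, fun p y q => act_inv_eq (by rw [e, hi])⟩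

lemma mem_of_fixes (hu : ∀ x : E n, (u x).1 ∈ T) (hum : ∀ x : E n, (um x).1 ∈ T)
    {g : specialOrthogonal n} (h0 : act g (mk 1 0 0) = mk 1 0 0)
    (h1 : act g (mk 0 0 1) = mk 0 0 1) : g ∈ T := by
  have hmid : ∀ y : E n, ∃ y', act g (mk 0 y 0) = mk 0 y' 0 := by
    intro y
    obtain ⟨p, y', q, e⟩ := exists_mk (act g (mk 0 y 0))
    have hQ := Q_act g (mk 0 y 0)
    have hQ0 := Q_act g (mk 0 y 0 + mk 1 0 0)
    have hQ1 := Q_act g (mk 0 y 0 + mk 0 0 1)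
    rw [act_add, h0, e, mk_add, mk_add, Q_mk, Q_mk] at hQ0
    rw [act_add, h1, e, mk_add, mk_add, Q_mk, Q_mk] at hQ1
    rw [e, Q_mk, Q_mk] at hQ
    simp only [add_zero] at hQ0 hQ1
    -- Adding an isotropic vector fixed by `g` isolates one cross term of `Q`: orthogonality to both
    -- axes forces `p = q = 0`.
    obtain rfl : p = 0 := by linarith
    obtain rfl : q = 0 := by linarith
    exact ⟨y', e⟩
  choose f hf using hmid
  let F : E n →ₗᵢ[ℝ] E n :=
    { toFun := f
      map_add' := fun x y => by
        have h := act_add g (mk 0 x 0) (mk 0 y 0)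
        rw [hf, hf, mk_add, mk_add, add_zero, hf, mk_inj] at h
        exact h.2.1
      map_smul' := fun c x => by
        have h := act_smul g c (mk 0 x 0)
        rw [hf, smul_mk, smul_mk, mul_zero, hf, mk_inj] at h
        exact h.2.1
      norm_map' := fun x => by
        have h := Q_act g (mk 0 x 0)
        rw [hf, Q_mk, Q_mk] at h
        have h' : ‖f x‖ ^ 2 = ‖x‖ ^ 2 := by linarith
        exact (pow_left_inj₀ (norm_nonneg _) (norm_nonneg _) two_ne_zero).mp h' }
  have hg : ∀ p y q, act g (mk p y q) = mk p (f y) q := by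
    intro p y q
    have e : mk p y q = p • mk 1 0 0 + mk 0 y 0 + q • mk 0 0 1 := by
      simp [smul_mk, mk_add]
    rw [e, act_add, act_add, act_smul, act_smul, h0, h1, hf]
    simp [smul_mk, mk_add]
  rcases exists_mem_act_isometry hu hum (F.toLinearIsometryEquiv rfl) with ⟨h, hh, e⟩ | ⟨h, hh, e⟩
  · have : g = h := act_ext fun p y q => by rw [hg, e]; rfl
    exact this ▸ hh
  -- In the odd case `h⁻¹ * g` would be the bare swap of the axes.
  · refine (exists_mk_ne_flip (h⁻¹ * g) fun p y q => ?_).elim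
    rw [act_mul, hg]
    exact act_inv_eq (e q y p)

/-- Big-cell factorization: an element of the form `u⁻ b` carries the first axis vector to its image
under `g`, then some `u` corrects the last one, and what remains fixes both. -/
lemma mem_of_pos (hn : 2 ≤ n) (hu : ∀ x : E n, (u x).1 ∈ T) (hum : ∀ x : E n, (um x).1 ∈ T)
    {g : specialOrthogonal n} (hg : 0 < act g (mk 1 0 0) (.inl ())) : g ∈ T := by
  obtain ⟨p, y, q, e⟩ := exists_mk (act g (mk 1 0 0))
  rw [e] at hg
  change 0 < p at hg
  have hQ := Q_act g (mk 1 0 0)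
  rw [e, Q_mk, Q_mk] at hQ
  simp only [mul_zero, norm_zero] at hQ
  obtain ⟨t, ht⟩ : ∃ t, Real.exp (2 * t) = p := ⟨Real.log p / 2, by
    rw [mul_div_cancel₀ _ two_ne_zero, Real.exp_log hg]⟩
  -- `b(t)` gives the coordinate `p`, and `u⁻(y / (2p))` then gives `y`; the last coordinate is
  -- forced to be `q` by `4pq = ‖y‖²`.
  set h : specialOrthogonal n := (um ((2 * p)⁻¹ • y)).1 * (b n t).1 with hh
  have hhT : h ∈ T := T.mul_mem (hum _) (b_mem hn hu hum t)
  have he : act h (mk 1 0 0) = mk p y q := by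
    rw [hh, act_mul]
    refine (congrArg (act _) (bMat_mulVec_mk t 1 0 0)).trans
      ((umMat_mulVec_mk _ _ _ _).trans ?_)
    rw [ht, mk_inj, norm_smul, norm_inv, Real.norm_of_nonneg (by positivity : 0 ≤ 2 * p), mul_pow,
      inner_zero_right, smul_smul]
    refine ⟨by ring, ?_, ?_⟩
    · rw [mul_one, mul_inv_cancel₀ (by positivity), zero_add, one_smul]
    · field_simp
      linarith
  have h0 : act (h⁻¹ * g) (mk 1 0 0) = mk 1 0 0 := by
    rw [act_mul, e]
    exact act_inv_eq he
  obtain ⟨p', y', q', e'⟩ := exists_mk (act (h⁻¹ * g) (mk 0 0 1))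
  have hQ1 := Q_act (h⁻¹ * g) (mk 0 0 1)
  have hQ2 := Q_act (h⁻¹ * g) (mk 0 0 1 + mk 1 0 0)
  rw [act_add, h0, e', mk_add, mk_add, Q_mk, Q_mk] at hQ2
  rw [e', Q_mk, Q_mk] at hQ1
  simp only [add_zero, norm_zero] at hQ1 hQ2
  obtain rfl : q' = 1 := by linarith
  have hu0 : ∀ x : E n, act (u x).1 (mk 1 0 0) = mk 1 0 0 := fun x =>
    (uMat_mulVec_mk x 1 0 0).trans (by simp)
  have hu1 : act (u ((2 : ℝ)⁻¹ • y')).1 (mk 0 0 1) = mk p' y' 1 := by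
    refine (uMat_mulVec_mk _ _ _ _).trans ?_
    rw [mk_inj, norm_smul, norm_inv, Real.norm_ofNat, smul_smul, inner_zero_right]
    refine ⟨?_, by norm_num, rfl⟩
    linarith
  have hmem : (u ((2 : ℝ)⁻¹ • y')).1⁻¹ * (h⁻¹ * g) ∈ T := by
    apply mem_of_fixes hu hum
    · rw [act_mul, h0]
      exact act_inv_eq (hu0 _)
    · rw [act_mul, e']
      exact act_inv_eq hu1
  rw [T.mul_mem_cancel_left (T.inv_mem (hu _)), T.mul_mem_cancel_left (T.inv_mem hhT)] at hmem
  exact hmem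

end Generation

/-- `SO(n,1)` is generated by its two opposite horospherical subgroups. -/
theorem eq_top_of_horospherical {n : ℕ} (hn : 2 ≤ n) (S : Subgroup (SO n))
    (hu : ∀ x : E n, u x ∈ S) (hum : ∀ x : E n, um x ∈ S) : S = ⊤ := by
  set T : Subgroup (specialOrthogonal n) := S.map (Subgroup.subtype _) with hT
  have hu' : ∀ x : E n, (u x).1 ∈ T := fun x => ⟨u x, hu x, rfl⟩
  have hum' : ∀ x : E n, (um x).1 ∈ T := fun x => ⟨um x, hum x, rfl⟩
  have hc : Continuous fun g : specialOrthogonal n => act g (mk 1 0 0) (.inl ()) := by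
    have : Continuous fun g : specialOrthogonal n => act g (mk 1 0 0) :=
      Continuous.matrix_mulVec (continuous_subtype_val.comp continuous_subtype_val)
        continuous_const
    exact (continuous_apply _).comp this
  have hnhds : (T : Set (specialOrthogonal n)) ∈ nhds 1 := by
    have h1 : (1 : specialOrthogonal n) ∈
        {g : specialOrthogonal n | 0 < act g (mk 1 0 0) (.inl ())} := by
      change 0 < act 1 (mk 1 0 0) (.inl ())
      rw [act_one]
      exact one_pos
    exact Filter.mem_of_superset ((isOpen_lt continuous_const hc).mem_nhds h1)
      fun g hg => mem_of_pos hn hu' hum' hg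
  -- A subgroup containing a neighbourhood of the identity is open, hence closed, so it contains the
  -- identity component.
  have hopen : IsOpen (T : Set (specialOrthogonal n)) := T.isOpen_of_mem_nhds hnhds
  have hclopen : IsClopen (T : Set (specialOrthogonal n)) :=
    ⟨T.isClosed_of_isOpen hopen, hopen⟩
  rw [eq_top_iff]
  intro g _
  obtain ⟨g', hg', e⟩ := hclopen.connectedComponent_subset T.one_mem g.2
  exact (Subtype.ext e : g' = g) ▸ hg'

/-! ### Bounded orbits and contracted elements in a representation -/

lemma eq_zero_of_pow_mul_add_bounded {V : Type*} [NormedAddCommGroup V] [NormedSpace ℝ V]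
    {x y : V} {C : ℝ} (h : ∀ m : ℕ, ‖x + (m : ℝ) • y‖ ≤ C) : y = 0 := by
  by_contra hy
  have hy' : 0 < ‖y‖ := norm_pos_iff.mpr hy
  obtain ⟨m, hm⟩ := exists_nat_gt ((C + ‖x‖) / ‖y‖)
  rw [div_lt_iff₀ hy'] at hm
  have h1 : ‖(m : ℝ) • y‖ = m * ‖y‖ := by rw [norm_smul, Real.norm_natCast]
  have h2 := norm_sub_le (x + (m : ℝ) • y) x
  rw [add_sub_cancel_left, h1] at h2
  linarith [h m]

/-- A vector with bounded orbit under a unipotent operator is fixed. -/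
lemma fixed_of_unipotent_of_bounded {V : Type*} [NormedAddCommGroup V] [NormedSpace ℝ V]
    {T : V →L[ℝ] V} {r : ℕ} (hT : (T - 1) ^ r = 0) {v : V} {C : ℝ}
    (hC : ∀ m : ℕ, ‖(T ^ m) v‖ ≤ C) : T v = v := by
  classical
  set N := T - 1 with hN
  have hex : ∃ j, (N ^ j) v = 0 := ⟨r, by rw [hT]; rfl⟩
  have hj := Nat.find_spec hex
  rcases hk : Nat.find hex with _ | _ | j
  · rw [hk] at hj
    have : v = 0 := by simpa using hj
    rw [this, map_zero]
  · rw [hk] at hj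
    have h : T v - v = 0 := by simpa [hN] using hj
    exact sub_eq_zero.mp h
  · rw [hk] at hj
    have hne : (N ^ (j + 1)) v ≠ 0 := Nat.find_min hex (by omega)
    refine (hne ?_).elim
    have hcomm : Commute T (N ^ j) :=
      (((Commute.refl T).sub_right (Commute.one_right T))).pow_right j
    have hNx : N ((N ^ (j + 1)) v) = 0 := by
      rw [← mul_apply_eq_comp, ← pow_succ']
      exact hj
    have hTN : T = N + 1 := by rw [hN, sub_add_cancel]
    -- `N ^ (j + 1)` is the last power not killing `v`, so on `(N ^ j) v` the iterates of `T` grow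
    -- linearly.
    have hm : ∀ m : ℕ, (T ^ m) ((N ^ j) v) = (N ^ j) v + (m : ℝ) • (N ^ (j + 1)) v := by
      intro m
      induction m with
      | zero => simp
      | succ m ih =>
        rw [pow_succ', mul_apply_eq_comp, ih, hTN, add_apply,
          map_add, map_smul, hNx, ← mul_apply_eq_comp N, ← pow_succ',
          one_apply_eq_self]
        push_cast
        module
    refine eq_zero_of_pow_mul_add_bounded (x := (N ^ j) v) (C := ‖N ^ j‖ * C) fun m => ?_
    rw [← hm, ← mul_apply_eq_comp, (hcomm.pow_left m).eq,
      mul_apply_eq_comp]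
    exact ((N ^ j).le_opNorm _).trans (mul_le_mul_of_nonneg_left (hC m) (norm_nonneg _))

/-- The operator `ρ(g)` on a finite-dimensional normed space as a continuous linear map. -/
def op {G V : Type*} [Group G] [NormedAddCommGroup V] [NormedSpace ℝ V] [FiniteDimensional ℝ V]
    (ρ : Representation ℝ G V) (g : G) : V →L[ℝ] V := LinearMap.toContinuousLinearMap (ρ g)

/-- The vectors whose forward orbit under `D` is bounded. -/
def boundedSpace {G V : Type*} [Group G] [NormedAddCommGroup V] [NormedSpace ℝ V]
    (ρ : Representation ℝ G V) (D : ℝ → G) : Submodule ℝ V where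
  carrier := {v | (fun t => ρ (D t) v) =O[atTop] fun _ => (1 : ℝ)}
  add_mem' := by
    intro v w hv hw
    simpa only [mem_ofPred_eq, map_add] using IsBigO.add hv hw
  zero_mem' := by
    simpa only [mem_ofPred_eq, map_zero] using isBigO_zero _ _
  smul_mem' := by
    intro c v hv
    refine IsBigO.congr_left (IsBigO.const_smul_left hv c) fun t => ?_
    rw [map_smul, Pi.smul_apply]

/-- The weight spaces of nonpositive weight consist of vectors with bounded forward orbit. -/
lemma nonposSpace_le_boundedSpace {G V : Type*} [Group G]
    [NormedAddCommGroup V] [NormedSpace ℝ V] (ρ : Representation ℝ G V) (D : ℝ → G) :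
    nonposSpace ρ D ≤ boundedSpace ρ D := by
  refine iSup₂_le fun w hw v hv => ?_
  have hv' : ∀ t : ℝ, ρ (D t) v = Real.exp (w * t) • v := hv
  refine IsBigO.of_bound ‖v‖ ?_
  filter_upwards [eventually_ge_atTop 0] with t ht
  rw [hv', norm_smul, Real.norm_eq_abs, Real.abs_exp, norm_one, mul_one]
  exact mul_le_of_le_one_left (norm_nonneg v)
    (Real.exp_le_one_iff.mpr (mul_nonpos_of_nonpos_of_nonneg hw ht))

/-- Conjugation by `D(t)` contracts `g` to the identity as `t → ∞`. -/
def Contracts {G : Type*} [Group G] [TopologicalSpace G] (D : ℝ → G) (g : G) : Prop :=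
  Tendsto (fun t => D t * g * D (-t)) atTop (𝓝 1)

section Dynamics

variable {G V : Type*} [Group G] [NormedAddCommGroup V] [NormedSpace ℝ V] [FiniteDimensional ℝ V]
  {ρ : Representation ℝ G V} {D : ℝ → G}

lemma op_apply (g : G) (v : V) : op ρ g v = ρ g v := rfl

lemma op_one : op ρ 1 = 1 := by
  ext v
  simp [op_apply]

lemma op_mul (g h : G) : op ρ (g * h) = op ρ g * op ρ h := by
  ext v
  simp [op_apply]

lemma op_pow (g : G) (m : ℕ) : op ρ (g ^ m) = op ρ g ^ m := by
  induction m with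
  | zero => rw [pow_zero, pow_zero, op_one]
  | succ m ih => rw [pow_succ, pow_succ, op_mul, ih]

lemma apply_conj (hD : ∀ s t, D (s + t) = D s * D t) (h0 : D 0 = 1) (g : G) (t : ℝ) (v : V) :
    ρ (D t) (ρ g v) = op ρ (D t * g * D (-t)) (ρ (D t) v) := by
  have h : D (-t) * D t = 1 := by rw [← hD, neg_add_cancel, h0]
  rw [op_apply, ← Module.End.mul_apply, ← Module.End.mul_apply, ← map_mul, ← map_mul,
    mul_assoc _ (D (-t)), h, mul_one]

/-- An element inverting `D` carries vectors with bounded backward orbit to vectors with bounded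
forward orbit, and conversely. -/
lemma apply_mem_boundedSpace_iff {w : G} (hw : ∀ t, D t * w = w * D (-t)) {v : V} :
    ρ w v ∈ boundedSpace ρ D ↔ v ∈ boundedSpace ρ fun t => D (-t) := by
  have h1 : ∀ t, ρ (D t) (ρ w v) = op ρ w (ρ (D (-t)) v) := by
    intro t
    rw [op_apply, ← Module.End.mul_apply, ← Module.End.mul_apply, ← map_mul, ← map_mul, hw]
  have h2 : ∀ t, ρ (D (-t)) v = op ρ w⁻¹ (ρ (D t) (ρ w v)) := by
    intro t
    rw [h1, ← mul_apply_eq_comp, ← op_mul, inv_mul_cancel, op_one,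
      one_apply_eq_self]
  constructor
  · intro h
    refine IsBigO.congr_left ?_ fun t => (h2 t).symm
    exact ((op ρ w⁻¹).isBigO_comp _ _).trans h
  · intro h
    refine IsBigO.congr_left ?_ fun t => (h1 t).symm
    exact ((op ρ w).isBigO_comp _ _).trans h

/-- A vector with bounded backward orbit whose forward orbit tends to zero is zero. -/
lemma eq_zero_of_tendsto_zero (hD : ∀ s t, D (s + t) = D s * D t) (h0 : D 0 = 1) {v : V}
    (hv : v ∈ boundedSpace ρ fun t => D (-t))
    (hlim : Tendsto (fun t => ρ (D t) v) atTop (𝓝 0)) : v = 0 := by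
  set B := boundedSpace ρ fun t => D (-t) with hB
  have hinv : ∀ s, ∀ w ∈ B, ρ (D s) w ∈ B := by
    intro s w hw
    have e : ∀ t, ρ (D (-t)) (ρ (D s) w) = op ρ (D s) (ρ (D (-t)) w) := by
      intro t
      rw [op_apply, ← Module.End.mul_apply, ← Module.End.mul_apply, ← map_mul, ← map_mul, ← hD,
        ← hD, add_comm]
    refine IsBigO.congr_left ?_ fun t => (e t).symm
    exact ((op ρ (D s)).isBigO_comp _ _).trans hw
  -- Uniform boundedness turns pointwise bounds on the `D`-invariant space `B` into one constant,
  -- which then controls `v` as the image of `ρ (D m) v` under `D (-m)`.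
  obtain ⟨C, hC⟩ : ∃ C, ∀ m : ℕ, ‖op ρ (D (-(m : ℝ))) ∘L B.subtypeL‖ ≤ C := by
    apply banach_steinhaus
    rintro ⟨w, hw⟩
    have hw' : (fun m : ℕ => ρ (D (-(m : ℝ))) w) =O[atTop] fun _ => (1 : ℝ) :=
      IsBigO.comp_tendsto hw tendsto_natCast_atTop_atTop
    exact isBigO_one_nat_atTop_iff.mp hw'
  have hlim' : Tendsto (fun m : ℕ => C * ‖ρ (D m) v‖) atTop (𝓝 0) := by
    simpa using ((hlim.comp tendsto_natCast_atTop_atTop).norm).const_mul C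
  have hle : ∀ m : ℕ, ‖v‖ ≤ C * ‖ρ (D m) v‖ := by
    intro m
    have e : (op ρ (D (-(m : ℝ))) ∘L B.subtypeL) ⟨ρ (D m) v, hinv m v hv⟩ = v := by
      change ρ (D (-(m : ℝ))) (ρ (D m) v) = v
      rw [← Module.End.mul_apply, ← map_mul, ← hD, neg_add_cancel, h0, map_one,
        Module.End.one_apply]
    calc ‖v‖ = ‖(op ρ (D (-(m : ℝ))) ∘L B.subtypeL) ⟨ρ (D m) v, hinv m v hv⟩‖ := by rw [e]
      _ ≤ _ := ContinuousLinearMap.le_of_opNorm_le _ (hC m) _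
  have := ge_of_tendsto' hlim' hle
  exact norm_le_zero_iff.mp this

variable [TopologicalSpace G]

lemma op_continuous (hρ : ∀ w : V, Continuous fun h => ρ h w) : Continuous (op ρ) :=
  continuous_clm_apply.mpr hρ

lemma Contracts.tendsto_op (hρ : ∀ w : V, Continuous fun h => ρ h w) {g : G}
    (hg : Contracts D g) : Tendsto (fun t => op ρ (D t * g * D (-t))) atTop (𝓝 1) := by
  rw [← op_one (ρ := ρ)]
  exact ((op_continuous hρ).tendsto 1).comp hg

/-- A contracted element preserves the vectors with bounded forward orbit. -/
lemma Contracts.apply_mem (hρ : ∀ w : V, Continuous fun h => ρ h w)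
    (hD : ∀ s t, D (s + t) = D s * D t) (h0 : D 0 = 1) {g : G} (hg : Contracts D g) {v : V}
    (hv : v ∈ boundedSpace ρ D) : ρ g v ∈ boundedSpace ρ D := by
  refine IsBigO.congr_left ?_ fun t => (apply_conj hD h0 g t v).symm
  have h1 : (fun t => ‖op ρ (D t * g * D (-t))‖ * ‖ρ (D t) v‖) =O[atTop]
      fun _ => (1 : ℝ) * 1 :=
    ((hg.tendsto_op hρ).isBigO_one ℝ).norm_left.mul (IsBigO.norm_left hv)
  simp only [mul_one] at h1
  refine IsBigO.trans (IsBigO.of_bound 1 (Eventually.of_forall fun t => ?_)) h1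
  rw [one_mul, Real.norm_of_nonneg (by positivity)]
  exact ContinuousLinearMap.le_opNorm _ _

/-- If `v` and `gv` have bounded orbits and `g` is contracted, then `g` fixes `v`. -/
lemma Contracts.apply_eq (hρ : ∀ w : V, Continuous fun h => ρ h w)
    (hD : ∀ s t, D (s + t) = D s * D t) (h0 : D 0 = 1) {g : G} (hg : Contracts D g) {v : V}
    (hv : v ∈ boundedSpace ρ D) (hv' : v ∈ boundedSpace ρ fun t => D (-t))
    (hgv : ρ g v ∈ boundedSpace ρ fun t => D (-t)) : ρ g v = v := by
  rw [← sub_eq_zero]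
  refine eq_zero_of_tendsto_zero hD h0 (Submodule.sub_mem _ hgv hv') ?_
  have h1 : Tendsto (fun t => ‖op ρ (D t * g * D (-t)) - 1‖) atTop (𝓝 0) := by
    simpa using ((hg.tendsto_op hρ).sub_const 1).norm
  have h2 : (fun t => ‖op ρ (D t * g * D (-t)) - 1‖ * ‖ρ (D t) v‖) =o[atTop]
      fun _ => (1 : ℝ) * 1 :=
    -- The orbit of `ρ g v - v` is the conjugate of `g` minus the identity, which tends to zero,
    -- applied to the bounded orbit of `v`.
    ((isLittleO_one_iff ℝ).mpr h1).mul_isBigO (IsBigO.norm_left hv)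
  simp only [mul_one] at h2
  refine squeeze_zero_norm (fun t => ?_) ((isLittleO_one_iff ℝ).mp h2)
  rw [map_sub, apply_conj hD h0]
  exact (op ρ (D t * g * D (-t)) - 1).le_opNorm (ρ (D t) v)

/-- A contracted element acts unipotently. -/
lemma Contracts.unipotent (hρ : ∀ w : V, Continuous fun h => ρ h w)
    (hD : ∀ s t, D (s + t) = D s * D t) (h0 : D 0 = 1) {g : G} (hg : Contracts D g) :
    ∃ r, (op ρ g - 1) ^ r = 0 := by
  -- The characteristic polynomial is constant along the conjugates of `g`, which converge to the
  -- identity; so it is that of the identity, and Cayley–Hamilton gives nilpotency.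
  have hdet : ∀ x : ℝ, (x • (1 : V →L[ℝ] V) - op ρ g).det = (x • (1 : V →L[ℝ] V) - 1).det := by
    intro x
    have hconj : ∀ t, (x • (1 : V →L[ℝ] V) - op ρ (D t * g * D (-t))).det =
        (x • (1 : V →L[ℝ] V) - op ρ g).det := by
      intro t
      have h1 : op ρ (D t) * op ρ (D (-t)) = 1 := by
        rw [← op_mul, ← hD, add_neg_cancel, h0, op_one]
      have e : x • (1 : V →L[ℝ] V) - op ρ (D t * g * D (-t)) =
          op ρ (D t) * (x • (1 : V →L[ℝ] V) - op ρ g) * op ρ (D (-t)) := by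
        rw [op_mul, op_mul, mul_sub, sub_mul, mul_smul_comm, mul_one, smul_mul_assoc, h1]
      have hd : ∀ S T : V →L[ℝ] V, (S * T).det = S.det * T.det := fun S T =>
        map_mul LinearMap.det (S : V →ₗ[ℝ] V) (T : V →ₗ[ℝ] V)
      have h2 : (op ρ (D t)).det * (op ρ (D (-t))).det = 1 := by
        rw [← hd, h1]
        exact map_one LinearMap.det
      rw [e, hd, hd, mul_right_comm, h2, one_mul]
    have hlim : Tendsto (fun t => (x • (1 : V →L[ℝ] V) - op ρ (D t * g * D (-t))).det) atTop
        (𝓝 (x • (1 : V →L[ℝ] V) - 1).det) :=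
      (ContinuousLinearMap.continuous_det.tendsto _).comp ((hg.tendsto_op hρ).const_sub _)
    simp only [hconj] at hlim
    exact tendsto_nhds_unique tendsto_const_nhds hlim
  have hchar : (ρ g).charpoly = (1 : Module.End ℝ V).charpoly := by
    refine Polynomial.funext fun x => ?_
    rw [LinearMap.eval_charpoly, LinearMap.eval_charpoly]
    exact hdet x
  refine ⟨Module.finrank ℝ V, ?_⟩
  have h := LinearMap.aeval_self_charpoly (ρ g)
  rw [hchar, LinearMap.charpoly_one] at h
  simp only [map_pow, map_sub, Polynomial.aeval_X, map_one] at h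
  have e : ∀ m : ℕ, (((op ρ g - 1) ^ m : V →L[ℝ] V) : V →ₗ[ℝ] V) = (ρ g - 1) ^ m := by
    intro m
    induction m with
    | zero => rfl
    | succ m ih => rw [pow_succ, pow_succ, ← ih]; rfl
  exact ContinuousLinearMap.coe_injective ((e _).trans h)

/-- A vector fixed by `U(1)`, for a continuous one-parameter group `U` of contracted elements,
is fixed by the whole one-parameter group. -/
lemma apply_eq_of_contracts (hρ : ∀ w : V, Continuous fun h => ρ h w)
    (hD : ∀ s t, D (s + t) = D s * D t) (h0 : D 0 = 1)
    {U : ℝ → G} (hU : ∀ s t, U (s + t) = U s * U t) (hU0 : U 0 = 1) (hUc : Continuous U)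
    (hUD : ∀ t, Contracts D (U t)) {v : V} (hv : ρ (U 1) v = v) (t : ℝ) : ρ (U t) v = v := by
  have hzpow : ∀ m : ℤ, ρ (U m) v = v := by
    have hnat : ∀ m : ℕ, ρ (U m) v = v := by
      intro m
      induction m with
      | zero => rw [Nat.cast_zero, hU0, map_one, Module.End.one_apply]
      | succ m ih => rw [Nat.cast_succ, hU, map_mul, Module.End.mul_apply, hv, ih]
    intro m
    obtain ⟨j, rfl | rfl⟩ := m.eq_nat_or_neg
    · exact_mod_cast hnat j
    · push_cast
      nth_rewrite 1 [← hnat j]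
      rw [← Module.End.mul_apply, ← map_mul, ← hU, neg_add_cancel, hU0, map_one,
        Module.End.one_apply]
  obtain ⟨C, hC⟩ : ∃ C, ∀ s ∈ Icc (0 : ℝ) 1, ‖ρ (U s) v‖ ≤ C :=
    isCompact_Icc.exists_bound_of_continuousOn ((hρ v).comp hUc).continuousOn
  -- Integer times fix `v`, so the orbit is periodic and its bound over `[0, 1]` is global.
  have hC' : ∀ s, ‖ρ (U s) v‖ ≤ C := by
    intro s
    have e : ρ (U s) v = ρ (U (Int.fract s)) v := by
      rw [← Int.fract_add_floor s, hU, map_mul, Module.End.mul_apply, hzpow]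
      simp
    rw [e]
    exact hC _ ⟨Int.fract_nonneg s, (Int.fract_lt_one s).le⟩
  obtain ⟨r, hr⟩ := (hUD t).unipotent hρ hD h0
  refine fixed_of_unipotent_of_bounded hr (C := C) fun m => ?_
  have hpow : ∀ m : ℕ, U t ^ m = U (m * t) := by
    intro m
    induction m with
    | zero => rw [pow_zero, Nat.cast_zero, zero_mul, hU0]
    | succ m ih => rw [pow_succ, ih, ← hU, Nat.cast_succ, add_mul, one_mul]
  rw [← op_pow, hpow]
  exact hC' _

end Dynamics
-- The product group and its representations
section Product

variable {n k : ℕ}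

/-- `u⁻_k(x₁, …, x_k) = (u⁻(x₁), …, u⁻(x_k))`. -/
def ukm (x : Fin k → E n) : H n k := fun i => um (x i)

/-- The tuple of Weyl elements attached to the components of `x`. -/
def weylk (x : Fin k → E n) : H n k := fun i => weyl (x i)

lemma uk_add (x y : Fin k → E n) : uk (x + y) = uk x * uk y := funext fun i => u_add (x i) (y i)

lemma ukm_add (x y : Fin k → E n) : ukm (x + y) = ukm x * ukm y :=
  funext fun i => um_add (x i) (y i)

lemma uk_zero : uk (0 : Fin k → E n) = 1 := funext fun _ => u_zero n

lemma ukm_zero : ukm (0 : Fin k → E n) = 1 := funext fun _ => um_zero n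

lemma uk_eq (x : Fin k → E n) : uk x = ukm (inv x) * weylk x * ukm (inv x) :=
  funext fun i => u_eq (x i)

lemma uk_continuous : Continuous (uk : (Fin k → E n) → H n k) :=
  continuous_pi fun i => (u_continuous n).comp (continuous_apply i)

lemma ukm_continuous : Continuous (ukm : (Fin k → E n) → H n k) :=
  continuous_pi fun i => (um_continuous n).comp (continuous_apply i)

variable (η : Fin k → ℝ)

lemma b_zero : b n 0 = 1 := by
  have h := b_add n 0 0
  rw [add_zero] at h
  exact (mul_eq_left.mp h.symm)

lemma a_add (s t : ℝ) : a n η (s + t) = a n η s * a n η t :=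
  funext fun i => by
    change b n (η i * (s + t)) = b n (η i * s) * b n (η i * t)
    rw [mul_add, b_add]

lemma a_zero : a n η 0 = 1 :=
  funext fun i => by
    change b n (η i * 0) = 1
    rw [mul_zero, b_zero]

lemma a_mul_weylk {x : Fin k → E n} (hx : InvDefined x) (t : ℝ) :
    a n η t * weylk x = weylk x * a n η (-t) :=
  funext fun i => by
    change b n (η i * t) * weyl (x i) = weyl (x i) * b n (η i * -t)
    rw [b_mul_weyl _ (hx i), mul_neg]

lemma b_conj_u (t : ℝ) (x : E n) : b n t * u x * b n (-t) = u (Real.exp (2 * t) • x) := by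
  rw [b_mul_u, mul_assoc, ← b_add, add_neg_cancel, b_zero, mul_one]

lemma b_conj_um (t : ℝ) (x : E n) : b n t * um x * b n (-t) = um (Real.exp (-(2 * t)) • x) := by
  rw [b_mul_um, mul_assoc, ← b_add, add_neg_cancel, b_zero, mul_one]

lemma tendsto_exp_smul {r : ℝ} (hr : 0 < r) (x : E n) :
    Tendsto (fun t : ℝ => Real.exp (-(2 * (r * t))) • x) atTop (𝓝 0) := by
  have h : Tendsto (fun t : ℝ => Real.exp (-(2 * (r * t)))) atTop (𝓝 0) := by
    refine Real.tendsto_exp_neg_atTop_nhds_zero.comp ?_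
    exact (tendsto_id.const_mul_atTop hr).const_mul_atTop two_pos
  simpa using h.smul_const x

variable {η}

lemma contracts_ukm (hη : ∀ i, 0 < η i) (x : Fin k → E n) : Contracts (a n η) (ukm x) := by
  have e : (fun t => a n η t * ukm x * a n η (-t)) =
      fun t => ukm fun i => Real.exp (-(2 * (η i * t))) • x i := by
    ext1 t
    ext1 i
    change b n (η i * t) * um (x i) * b n (η i * -t) = um (Real.exp (-(2 * (η i * t))) • x i)
    rw [mul_neg, b_conj_um]
  rw [Contracts, e, ← ukm_zero (n := n)]
  exact (ukm_continuous.tendsto 0).comp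
    (tendsto_pi_nhds.mpr fun i => tendsto_exp_smul (hη i) (x i))

lemma contracts_uk (hη : ∀ i, 0 < η i) (x : Fin k → E n) :
    Contracts (fun t => a n η (-t)) (uk x) := by
  have e : (fun t => a n η (-t) * uk x * a n η (- -t)) =
      fun t => uk fun i => Real.exp (-(2 * (η i * t))) • x i := by
    ext1 t
    ext1 i
    change b n (η i * -t) * u (x i) * b n (η i * - -t) = u (Real.exp (-(2 * (η i * t))) • x i)
    rw [mul_neg (η i) (-t), b_conj_u]
    congr 3
    ring
  rw [Contracts, e, ← uk_zero (n := n)]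
  exact (uk_continuous.tendsto 0).comp
    (tendsto_pi_nhds.mpr fun i => tendsto_exp_smul (hη i) (x i))

/-- The Weyl factorization inverts `A` only when no component vanishes; a sum of two such tuples
reaches the remaining ones. -/
lemma exists_invDefined_add (hn : 2 ≤ n) (x : Fin k → E n) :
    ∃ y z, InvDefined y ∧ InvDefined z ∧ x = y + z := by
  obtain ⟨e, he⟩ := exists_unit hn
  have he0 : e ≠ 0 := by
    rintro rfl
    simp at he
  classical
  refine ⟨fun i => if x i = 0 then e else (2 : ℝ) • x i,
    fun i => if x i = 0 then -e else -x i, fun i => ?_, fun i => ?_, funext fun i => ?_⟩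
  · by_cases h : x i = 0 <;> simp [h, he0]
  · by_cases h : x i = 0 <;> simp [h, he0]
  · by_cases h : x i = 0
    · simp [h]
    · simp only [h, if_false, Pi.add_apply]
      module

/-- `SO(n,1)^k` is generated by its two opposite horospherical subgroups. -/
lemma eq_top_of_horospherical_pi (hn : 2 ≤ n) (S : Subgroup (H n k))
    (hu : ∀ x : Fin k → E n, uk x ∈ S) (hum : ∀ x : Fin k → E n, ukm x ∈ S) : S = ⊤ := by
  classical
  rw [eq_top_iff]
  intro h _
  refine Subgroup.pi_mem_of_mulSingle_mem h fun i => ?_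
  have htop : S.comap (MonoidHom.mulSingle (fun _ => SO n) i) = ⊤ := by
    apply eq_top_of_horospherical hn
    · intro x
      have e : Pi.mulSingle i (u x) = uk (Pi.single i x) := by
        ext1 j
        by_cases hj : j = i
        · subst hj
          simp [uk]
        · simp [uk, hj, u_zero]
      exact (e ▸ hu _ : (Pi.mulSingle i (u x) : H n k) ∈ S)
    · intro x
      have e : Pi.mulSingle i (um x) = ukm (Pi.single i x) := by
        ext1 j
        by_cases hj : j = i
        · subst hj
          simp [ukm]
        · simp [ukm, hj, um_zero]
      exact (e ▸ hum _ : (Pi.mulSingle i (um x) : H n k) ∈ S)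
  have : h i ∈ S.comap (MonoidHom.mulSingle (fun _ => SO n) i) := htop ▸ Subgroup.mem_top _
  exact this

variable {V : Type*} [NormedAddCommGroup V] [NormedSpace ℝ V] [FiniteDimensional ℝ V]
  {ρ : Representation ℝ (H n k) V}

/-- If `v` and `u_k(x) v` have bounded forward orbits, then `u⁻_k(x⁻¹) v` has bounded forward and
backward orbits. -/
lemma ukm_inv_apply_mem (hρ : ∀ w : V, Continuous fun h => ρ h w) (hη : ∀ i, 0 < η i)
    {x : Fin k → E n} (hx : InvDefined x) {v : V}
    (hxv : ρ (uk x) v ∈ boundedSpace ρ (a n η)) :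
    ρ (ukm (inv x)) v ∈ boundedSpace ρ fun t => a n η (-t) := by
  rw [← apply_mem_boundedSpace_iff (a_mul_weylk η hx)]
  -- Removing the left factor `u⁻(x⁻¹)` of `u(x)` keeps the forward orbit bounded and leaves the
  -- Weyl element outermost.
  have h := (contracts_ukm hη (-inv x)).apply_mem hρ (a_add η) (a_zero η) hxv
  rwa [← Module.End.mul_apply, ← map_mul, uk_eq, ← mul_assoc, ← mul_assoc, ← ukm_add,
    neg_add_cancel, ukm_zero, one_mul, map_mul, Module.End.mul_apply] at h

/-- A vector with bounded orbit that is fixed by the contracting horospherical subgroup is fixed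
by the whole group. -/
lemma fixed_of_ukm_fixed (hn : 2 ≤ n) (hρ : ∀ w : V, Continuous fun h => ρ h w)
    (hη : ∀ i, 0 < η i) {v : V} (hv : v ∈ boundedSpace ρ (a n η))
    (hv' : v ∈ boundedSpace ρ fun t => a n η (-t))
    (hfix : ∀ z : Fin k → E n, ρ (ukm z) v = v) (h : H n k) : ρ h v = v := by
  have hD : ∀ s t : ℝ, a n η (-(s + t)) = a n η (-s) * a n η (-t) := by
    intro s t
    rw [neg_add, a_add]
  have hD0 : a n η (-0) = 1 := by rw [neg_zero, a_zero]
  have hinv : ∀ x : Fin k → E n, InvDefined x → ρ (uk x) v = v := by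
    intro x hx
    -- Time is reversed here: `a(-t)` contracts `u`, so what must be checked is that `u(x)v` is
    -- bounded under `a(t)`.
    refine (contracts_uk hη x).apply_eq hρ hD hD0 hv' (by simpa only [neg_neg] using hv) ?_
    simp only [neg_neg]
    have e : ρ (uk x) v = ρ (ukm (inv x)) (ρ (weylk x) v) := by
      rw [uk_eq, map_mul, Module.End.mul_apply, hfix, map_mul, Module.End.mul_apply]
    rw [e]
    exact (contracts_ukm hη (inv x)).apply_mem hρ (a_add η) (a_zero η)
      ((apply_mem_boundedSpace_iff (a_mul_weylk η hx)).mpr hv')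
  let S : Subgroup (H n k) :=
    { carrier := {h | ρ h v = v}
      one_mem' := by
        change ρ 1 v = v
        rw [map_one, Module.End.one_apply]
      mul_mem' := fun {g h} (hg : ρ g v = v) (hh : ρ h v = v) => by
        change ρ (g * h) v = v
        rw [map_mul, Module.End.mul_apply, hh, hg]
      inv_mem' := fun {g} (hg : ρ g v = v) => by
        change ρ g⁻¹ v = v
        nth_rewrite 1 [← hg]
        rw [← Module.End.mul_apply, ← map_mul, inv_mul_cancel, map_one, Module.End.one_apply] }
  have hS : S = ⊤ := by
    refine eq_top_of_horospherical_pi hn S (fun x => ?_) hfix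
    obtain ⟨y, z, hy, hz, rfl⟩ := exists_invDefined_add hn x
    rw [uk_add]
    exact S.mul_mem (hinv y hy) (hinv z hz)
  have : h ∈ S := hS ▸ Subgroup.mem_top h
  exact this

/-- The vectors `z` such that `u⁻_k(z)` fixes `v`. -/
def ukmStabilizer (hρ : ∀ w : V, Continuous fun h => ρ h w) (hη : ∀ i, 0 < η i) (v : V) :
    Submodule ℝ (Fin k → E n) where
  carrier := {z | ρ (ukm z) v = v}
  zero_mem' := by
    change ρ (ukm 0) v = v
    rw [ukm_zero, map_one, Module.End.one_apply]
  add_mem' := by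
    intro y z (hy : ρ (ukm y) v = v) (hz : ρ (ukm z) v = v)
    change ρ (ukm (y + z)) v = v
    rw [ukm_add, map_mul, Module.End.mul_apply, hz, hy]
  smul_mem' := by
    intro t z (hz : ρ (ukm z) v = v)
    -- Closure under real scalars is not formal: it uses unipotency along the line through `z`.
    refine apply_eq_of_contracts (U := fun t : ℝ => ukm (t • z)) hρ (a_add η) (a_zero η)
      (fun s t => ?_) ?_ ?_ (fun t => contracts_ukm hη _) ?_ t
    · rw [add_smul, ukm_add]
    · simp only [zero_smul, ukm_zero]
    · exact ukm_continuous.comp (continuous_id.smul continuous_const)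
    · rw [one_smul, hz]

end Product

end SOn1

end

/-! ### The theorem -/

open SOn1 in
theorem lemma4p4 {n k : ℕ} (hn : 2 ≤ n)
    (η : Fin k → ℝ) (hη : ∀ i, 0 < η i)
    {c d : ℝ} (hcd : c < d)
    (φ : ℝ → Fin k → SOn1.E n) (hφ : AnalyticOn ℝ φ (Set.Icc c d))
    (hgeom : SOn1.GeometricCondition c d φ)
    {V : Type*} [NormedAddCommGroup V] [NormedSpace ℝ V] [FiniteDimensional ℝ V]
    (ρ : Representation ℝ (SOn1.H n k) V) (hρ : ∀ w : V, Continuous fun h => ρ h w)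
    (v : V) (hv : v ≠ 0)
    (hφv : ∀ s ∈ Set.Icc c d, ρ (SOn1.uk (φ s)) v ∈ SOn1.nonposSpace ρ (SOn1.a n η)) :
    ∀ h : SOn1.H n k, ρ h v = v := by
  obtain ⟨s₀, hs₀, hae, hspan⟩ := hgeom
  have hbdd : ∀ s ∈ Icc c d, ρ (uk (φ s)) v ∈ boundedSpace ρ (a n η) :=
    fun s hs => nonposSpace_le_boundedSpace ρ _ (hφv s hs)
  set v₀ := ρ (uk (φ s₀)) v with hv₀
  have hv₀b : v₀ ∈ boundedSpace ρ (a n η) := hbdd s₀ hs₀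
  have hfwd : ∀ z, ρ (ukm z) v₀ ∈ boundedSpace ρ (a n η) := fun z =>
    (contracts_ukm hη z).apply_mem hρ (a_add η) (a_zero η) hv₀b
  have hbwd : ∀ s ∈ Icc c d, InvDefined (φ s - φ s₀) →
      ρ (ukm (inv (φ s - φ s₀))) v₀ ∈ boundedSpace ρ fun t => a n η (-t) := by
    intro s hs hs'
    refine ukm_inv_apply_mem hρ hη hs' ?_
    rw [hv₀, ← Module.End.mul_apply, ← map_mul, ← uk_add, sub_add_cancel]
    exact hbdd s hs
  -- Since `c < d`, the interval has positive measure, so the almost-everywhere condition holds at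
  -- some point.
  obtain ⟨s₁, hs₁, hs₁'⟩ : ∃ s ∈ Icc c d, InvDefined (φ s - φ s₀) := by
    have hne : (ae (volume.restrict (Icc c d))).NeBot := by
      rw [ae_neBot, Ne, Measure.restrict_eq_zero, Real.volume_Icc, ENNReal.ofReal_eq_zero]
      linarith
    obtain ⟨s, hs, hs'⟩ := ((ae_restrict_mem measurableSet_Icc).and hae).exists
    exact ⟨s, hs, hs'⟩
  set v₁ := ρ (ukm (inv (φ s₁ - φ s₀))) v₀ with hv₁
  have hmem : ∀ s ∈ Icc c d, InvDefined (φ s - φ s₀) →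
      inv (φ s - φ s₀) - inv (φ s₁ - φ s₀) ∈ ukmStabilizer hρ hη v₁ := by
    intro s hs hs'
    refine (contracts_ukm hη _).apply_eq hρ (a_add η) (a_zero η) (hfwd _)
      (hbwd s₁ hs₁ hs₁') ?_
    rw [hv₁, ← Module.End.mul_apply, ← map_mul, ← ukm_add, sub_add_cancel]
    exact hbwd s hs hs'
  have htop : ukmStabilizer hρ hη v₁ = ⊤ := by
    by_contra hne
    -- A difference for an arbitrary pair is a difference of two differences based at `s₁`.
    refine hspan ⟨_, hne, fun s hs s' hs' h h' => ?_⟩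
    have := Submodule.sub_mem _ (hmem s hs h) (hmem s' hs' h')
    rwa [sub_sub_sub_cancel_right] at this
  have hfix : ∀ h, ρ h v₁ = v₁ :=
    fixed_of_ukm_fixed hn hρ hη (hfwd _) (hbwd s₁ hs₁ hs₁') fun z =>
      (htop ▸ Submodule.mem_top : z ∈ ukmStabilizer hρ hη v₁)
  have hv₁' : v₁ = ρ (ukm (inv (φ s₁ - φ s₀)) * uk (φ s₀)) v := by
    rw [hv₁, hv₀, map_mul, Module.End.mul_apply]
  have hvv : v = v₁ := by
    rw [← hfix (ukm (inv (φ s₁ - φ s₀)) * uk (φ s₀))⁻¹, hv₁', ← Module.End.mul_apply, ← map_mul,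
      inv_mul_cancel, map_one, Module.End.one_apply]
  rw [hvv]
  exact hfix
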